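/- **Setting.** Let $\tau\in[0,1]$ be a constant. For each $n\ge 1$ let $V_1,V_2$ be a partition of $\{1,\dots,n\}$ with $|V_1|=\tau n$ (or, if $\tau n$ is not an integer, $|V_1|$ an integer nearest to $\tau n$), and let $r_s=r_s(n)$, $r_d=r_d(n)$ be real numbers with $0\le r_d\le r_s\le 1/2$. Let $X_1,\dots,X_n$ be independent random variables, uniform on $[0,1]$, and put $d(x,y)=\min\{|x-y|,\,1-|x-y|\}$. The geometric block model $\mathcal G_n(r_s,r_d)$ is the random graph on $\{1,\dots,n\}$ with adjacency matrix $A$ given by $A_{ii}=0$ and, for $i\ne j$, $A_{ij}=1$ if $d(X_i,X_j)\le r_s$ and $i,j$ lie in the same one of $V_1,V_2$, or if $d(X_i,X_j)\le r_d$ and $i,j$ lie in different ones; otherwise $A_{ij}=0$. Let $d_i=\sum_j A_{ij}$. The average clustering coefficient is $$\overline{\mathcal C}_n=\frac1n\sum_{i=1}^n\frac{\sum_{j\ne k}A_{ij}A_{jk}A_{ki}}{d_i(d_i-1)},$$ where the terms with $d_i\in\{0,1\}$ are set to zero. **Theorem.** Suppose that $r_s=\Theta(r_d)$, that $n r_s\to\infty$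 as $n\to\infty$, and that $r_s\le 1/3$ for all sufficiently large $n$. Below, $o_P(1)$ denotes a sequence of random variables that converges to zero in probability as $n\to\infty$. (I) If $r_d\le r_s<2r_d$ for all sufficiently large $n$, then $$\overline{\mathcal C}_n=\frac{\tau\bigl[3\tau^2r_s^2+(1-\tau^2)(4r_sr_d-r_s^2)\bigr]}{4\bigl(\tau r_s+(1-\tau)r_d\bigr)^2}+\frac{(1-\tau)\bigl[3(1-\tau)^2r_s^2+\tau(2-\tau)(4r_sr_d-r_s^2)\bigr]}{4\bigl(\tau r_d+(1-\tau)r_s\bigr)^2}+o_P(1).$$ (II) If $r_s\ge 2r_d$ for all sufficiently large $n$, then $$\overline{\mathcal C}_n=\frac{\tau\bigl[3\tau^2r_s^2+4r_d^2(1-\tau^2)\bigr]}{4\bigl(\tau r_s+(1-\tau)r_d\bigr)^2}+\frac{(1-\tau)\bigl[3(1-\tau)^2r_s^2+4r_d^2\,\tau(2-\tau)\bigr]}{4\bigl(\tau r_d+(1-\tau)r_s\bigr)^2}+o_P(1).$$ -/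

import Mathlib

open MeasureTheory ProbabilityTheory Filter Topology

noncomputable section

open Classical in
/-- The average clustering coefficient of a graph on a finite vertex set: the average over the
vertices `i` of `(∑_{j ≠ k} A i j * A j k * A k i) / (d i * (d i - 1))`, where `A` is the adjacency
matrix and `d i` the degree, a term with `d i = 0` or `d i = 1` being set to zero. -/
def avgClustering {V : Type*} [Fintype V] (G : SimpleGraph V) : ℝ :=
  (1 / (Fintype.card V : ℝ)) * ∑ i : V,
    if G.degree i ≤ 1 then 0
    else (∑ j : V, ∑ k : V,
        if j ≠ k then G.adjMatrix ℝ i j * G.adjMatrix ℝ j k * G.adjMatrix ℝ k i else 0) /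
      ((G.degree i : ℝ) * ((G.degree i : ℝ) - 1))

/-- The periodic distance on the unit interval. -/
def circDist (x y : ℝ) : ℝ := min |x - y| (1 - |x - y|)

theorem circDist_comm (x y : ℝ) : circDist x y = circDist y x := by
  simp only [circDist, abs_sub_comm x y]

open Classical in
/-- The graph of the Geometric Block Model with within-community radius `rs` and between-community
radius `rd`, for the positions `x i` of the vertices; the two communities are the set `V₁` and its
complement. -/
def gbmGraph {n : ℕ} (V₁ : Finset (Fin n)) (rs rd : ℝ) (x : Fin n → ℝ) :
    SimpleGraph (Fin n) where
  Adj i j := i ≠ j ∧ circDist (x i) (x j) ≤ rd + (rs - rd) * (if (i ∈ V₁ ↔ j ∈ V₁) then 1 else 0)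
  symm := ⟨fun i j h => by
    refine ⟨h.1.symm, ?_⟩
    simpa only [circDist_comm (x j), iff_comm (a := j ∈ V₁)] using h.2⟩
  loopless := ⟨fun _ h => h.1 rfl⟩

/-- `Y n = o_P(1)`: the random variables `Y n`, each on its own probability space, converge to zero
in probability. -/
def IsLittleOPOne {Ω : ℕ → Type*} [∀ n, MeasurableSpace (Ω n)] (μ : ∀ n, Measure (Ω n))
    (Y : ∀ n, Ω n → ℝ) : Prop :=
  ∀ ε : ℝ, 0 < ε → Tendsto (fun n => μ n {ω | ε < |Y n ω|}) atTop (𝓝 0)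

end

noncomputable section

/-! The clustering coefficient of vertex `i` is a ratio `T / S`, where `S = d_i (d_i - 1)` counts
ordered pairs of neighbours and `T` counts those pairs that are adjacent (`avgClustering_gbmGraph`).
On the circle both depend only on the positions relative to `i`. Subtracting the position of `i`
while keeping it as the `i`-th coordinate is a surjective endomorphism of the torus, so it preserves
Haar measure and the new positions are again independent and uniform (`iIndepFun_relativePosition`);
no conditioning is needed.

`T` and `S` are then double sums of kernels in independent variables. Their variance is of order `(n
s)^3 + (n s)^2`, since pairs with no common index are uncorrelated (`variance_sum_sum_kernel_le`).
Their means are `n ^ 2` times explicit constants up to `O(n s ^ 2)`, by an exact computation of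
triangle probabilities (`triangleProb_eq`). As `S` has order `(n s)^2` when `s` and `d` are
comparable, `T / S` is close in `L¹` to the ratio of the constants (`abs_div_sub_div_le`), with
error `O((n s)^(-1/2) + (n s)^(-1) + n^(-1))`. Averaging over the vertices and applying Markov's
inequality gives convergence in probability. The two regimes differ only in the value of a `max` in
`mixedTriangleProb`. -/

/-! ### The unit circle and its norm -/

instance isProbabilityMeasure_volume_unitAddCircle :
    IsProbabilityMeasure (volume : Measure UnitAddCircle) :=
  ⟨UnitAddCircle.measure_univ⟩

theorem norm_coe_unitAddCircle_eq_min {w : ℝ} (hw : |w| ≤ 1) :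
    ‖(w : UnitAddCircle)‖ = min |w| (1 - |w|) := by
  have key : ∀ v : ℝ, 0 ≤ v → v ≤ 1 → ‖(v : UnitAddCircle)‖ = min v (1 - v) := by
    intro v h0 h1
    rw [UnitAddCircle.norm_eq, abs_sub_round_eq_min]
    rcases h1.lt_or_eq with h | rfl
    · rw [Int.fract_eq_self.2 ⟨h0, h⟩]
    · simp
  rcases abs_cases w with ⟨h, _⟩ | ⟨h, _⟩
  · rw [h] at hw ⊢
    exact key w (by linarith) hw
  · rw [h] at hw ⊢
    rw [← key (-w) (by linarith) hw, AddCircle.coe_neg, norm_neg]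

theorem circDist_eq_norm {x y : ℝ} (hx : x ∈ Set.Icc (0 : ℝ) 1) (hy : y ∈ Set.Icc (0 : ℝ) 1) :
    circDist x y = ‖(x : UnitAddCircle) - (y : UnitAddCircle)‖ := by
  rw [← AddCircle.coe_sub, norm_coe_unitAddCircle_eq_min, circDist]
  exact abs_le.2 ⟨by linarith [hx.1, hy.2], by linarith [hx.2, hy.1]⟩

theorem norm_unitAddCircle_le_half (x : UnitAddCircle) : ‖x‖ ≤ 1 / 2 := by
  simpa using AddCircle.norm_le_half_period (1 : ℝ) one_ne_zero (x := x)

/-! ### Triangle probabilities on the circle -/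

/-- The indicator of the event that `y` and `z` lie within `a` and `b` of the origin of the circle
and within `c` of each other. -/
def triangleKernel (a b c : ℝ) (y z : UnitAddCircle) : ℝ :=
  if ‖y‖ ≤ a ∧ ‖z‖ ≤ b ∧ ‖y - z‖ ≤ c then 1 else 0

theorem measurable_triangleKernel (a b c : ℝ) :
    Measurable fun p : UnitAddCircle × UnitAddCircle => triangleKernel a b c p.1 p.2 := by
  unfold triangleKernel
  have h1 : Measurable fun p : UnitAddCircle × UnitAddCircle => ‖p.1‖ := by fun_prop
  have h2 : Measurable fun p : UnitAddCircle × UnitAddCircle => ‖p.2‖ := by fun_prop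
  have h3 : Measurable fun p : UnitAddCircle × UnitAddCircle => ‖p.1 - p.2‖ := by fun_prop
  exact Measurable.ite ((measurableSet_le h1 measurable_const).inter
    ((measurableSet_le h2 measurable_const).inter (measurableSet_le h3 measurable_const)))
    measurable_const measurable_const

theorem triangleKernel_nonneg (a b c : ℝ) (y z : UnitAddCircle) : 0 ≤ triangleKernel a b c y z := by
  unfold triangleKernel; split_ifs <;> norm_num

theorem triangleKernel_le_one (a b c : ℝ) (y z : UnitAddCircle) : triangleKernel a b c y z ≤ 1 := by
  unfold triangleKernel; split_ifs <;> norm_num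

theorem triangleKernel_swap (a b c : ℝ) (y z : UnitAddCircle) :
    triangleKernel a b c y z = triangleKernel b a c z y := by
  unfold triangleKernel
  rw [norm_sub_rev]
  congr 1
  simp only [eq_iff_iff]; tauto

/-- The probability that two independent uniform points of the circle lie within `a` and `b` of the
origin and within `c` of each other. -/
def triangleProb (a b c : ℝ) : ℝ :=
  ∫ p : UnitAddCircle × UnitAddCircle, triangleKernel a b c p.1 p.2

theorem integrable_triangleKernel (a b c : ℝ) :
    Integrable fun p : UnitAddCircle × UnitAddCircle => triangleKernel a b c p.1 p.2 := by
  refine Integrable.of_bound (measurable_triangleKernel a b c).aestronglyMeasurable 1 ?_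
  refine ae_of_all _ fun p => ?_
  rw [Real.norm_of_nonneg (triangleKernel_nonneg ..)]
  exact triangleKernel_le_one ..

theorem triangleProb_swap (a b c : ℝ) : triangleProb a b c = triangleProb b a c := by
  unfold triangleProb
  rw [Measure.volume_eq_prod,
    ← integral_prod_swap (f := fun p : UnitAddCircle × UnitAddCircle => triangleKernel b a c p.1 p.2)]
  exact integral_congr_ae (ae_of_all _ fun p => triangleKernel_swap _ _ _ _ _)

theorem integral_indicator_norm_le {r : ℝ} (h0 : 0 ≤ r) (h1 : r ≤ 1 / 2) :
    ∫ y : UnitAddCircle, (if ‖y‖ ≤ r then (1 : ℝ) else 0) = 2 * r := by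
  have h : (fun y : UnitAddCircle => if ‖y‖ ≤ r then (1 : ℝ) else 0) =
      (Metric.closedBall (0 : UnitAddCircle) r).indicator 1 := by
    ext y
    by_cases h : ‖y‖ ≤ r <;> simp [h]
  rw [h, integral_indicator_one Metric.isClosed_closedBall.measurableSet, measureReal_def,
    AddCircle.volume_closedBall, min_eq_right (by linarith), ENNReal.toReal_ofReal (by linarith)]

theorem triangleProb_of_one_half_le {a b c : ℝ} (ha : 0 ≤ a) (ha' : a ≤ 1 / 2) (hb : 0 ≤ b)
    (hb' : b ≤ 1 / 2) (hc : 1 / 2 ≤ c) : triangleProb a b c = (2 * a) * (2 * b) := by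
  rw [← integral_indicator_norm_le ha ha', ← integral_indicator_norm_le hb hb', triangleProb,
    Measure.volume_eq_prod, ← integral_prod_mul]
  refine integral_congr_ae (ae_of_all _ fun p => ?_)
  have := (norm_unitAddCircle_le_half (p.1 - p.2)).trans hc
  simp only [triangleKernel, this, and_true]
  split_ifs <;> simp_all

/-- Radii at most `1 / 3` rule out wrapping, so the admissible `z` form the intersection of the
intervals of radius `b` about `0` and `c` about `x`. One contains the other until `|x|` exceeds `|b
- c|`; after that the overlap shrinks linearly, and `a ≤ b + c` keeps it nonempty. -/
theorem integral_triangleKernel_right {a b c x : ℝ} (ha : a ≤ 1 / 3) (hb0 : 0 ≤ b) (hb : b ≤ 1 / 3)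
    (hc : c ≤ 1 / 3) (hbc : a ≤ b + c) (hbc0 : 0 ≤ c) (hx : |x| < a) :
    ∫ z : UnitAddCircle, triangleKernel a b c x z =
      2 * min b c - max 0 (|x| - |b - c|) := by
  -- On the fundamental domain centred at `0` the circle norm is the absolute value.
  rw [← UnitAddCircle.integral_preimage (-(1 / 2))]
  have h1 : ∀ z ∈ Set.Ioc (-(1 / 2) : ℝ) (-(1 / 2) + 1), triangleKernel a b c x (z : ℝ) =
      (Set.Icc (max (-b) (x - c)) (min b (x + c))).indicator 1 z := by
    intro z hz
    have hz1 : |z| ≤ 1 / 2 := abs_le.2 ⟨by linarith [hz.1], by linarith [hz.2]⟩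
    have n1 : ‖(x : UnitAddCircle)‖ ≤ a := by
      rw [norm_coe_unitAddCircle_eq_min (by linarith)]
      exact min_le_of_left_le hx.le
    have n2 : ‖(z : UnitAddCircle)‖ = |z| := by
      rw [norm_coe_unitAddCircle_eq_min (by linarith), min_eq_left (by linarith)]
    have n3 : |x - z| ≤ 1 := (abs_sub x z).trans (by linarith)
    have n4 : |z| ≤ b → |x - z| < 2 / 3 := fun h => (abs_sub x z).trans_lt (by linarith)
    have n5 : ‖(x : UnitAddCircle) - (z : UnitAddCircle)‖ = min |x - z| (1 - |x - z|) := by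
      rw [← AddCircle.coe_sub, norm_coe_unitAddCircle_eq_min n3]
    simp only [triangleKernel, n1, n2, n5, true_and, Set.indicator_apply, Pi.one_apply]
    congr 1
    simp only [Set.mem_Icc, max_le_iff, le_min_iff, eq_iff_iff, min_le_iff]
    constructor
    · rintro ⟨hb1, hb2⟩
      have := n4 hb1
      have hb2 : |x - z| ≤ c := by
        rcases hb2 with h | h
        · exact h
        -- The other way round the circle has length `1 - |x - z| > 1 / 3 ≥ c`.
        · linarith
      rw [abs_le] at hb1 hb2
      exact ⟨⟨hb1.1, by linarith⟩, hb1.2, by linarith⟩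
    · rintro ⟨⟨h1, h2⟩, h3, h4⟩
      exact ⟨abs_le.2 ⟨h1, h3⟩, Or.inl (abs_le.2 ⟨by linarith, by linarith⟩)⟩
  rw [setIntegral_congr_fun measurableSet_Ioc h1, integral_indicator_one measurableSet_Icc,
    measureReal_restrict_apply measurableSet_Icc]
  have h2 : Set.Icc (max (-b) (x - c)) (min b (x + c)) ∩ Set.Ioc (-(1 / 2)) (-(1 / 2) + 1) =
      Set.Icc (max (-b) (x - c)) (min b (x + c)) := by
    refine Set.inter_eq_left.2 fun z hz => ⟨?_, ?_⟩
    · have := (le_max_left _ _).trans hz.1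
      linarith
    · have := hz.2.trans (min_le_left _ _)
      linarith
  rw [h2, Real.volume_real_Icc]
  rcases abs_cases x with ⟨e1, _⟩ | ⟨e1, _⟩ <;> rcases abs_cases (b - c) with ⟨e2, _⟩ | ⟨e2, _⟩ <;>
    rw [e1] at hx <;> rw [e1, e2] <;> grind

theorem integral_abs_sub_pos {a m δ : ℝ} (ha : 0 ≤ a) (hδ : 0 ≤ δ) :
    ∫ x in (-a)..a, (m - max 0 (|x| - δ)) = 2 * a * m - (max 0 (a - δ)) ^ 2 := by
  have hc : Continuous fun x : ℝ => max 0 (|x| - δ) := by fun_prop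
  have key : ∫ x in (0 : ℝ)..a, max 0 (|x| - δ) = (max 0 (a - δ)) ^ 2 / 2 := by
    rcases le_total a δ with h | h
    · rw [max_eq_left (by linarith)]
      rw [intervalIntegral.integral_congr (g := fun _ => 0)]
      · simp
      · intro x hx
        rw [Set.uIcc_of_le ha] at hx
        simp only
        rw [abs_of_nonneg hx.1, max_eq_left]
        linarith [hx.2]
    · rw [← intervalIntegral.integral_add_adjacent_intervals (b := δ)
        (hc.intervalIntegrable _ _) (hc.intervalIntegrable _ _)]
      rw [intervalIntegral.integral_congr (a := 0) (b := δ) (g := fun _ => 0),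
        intervalIntegral.integral_congr (a := δ) (b := a) (g := fun x => x - δ)]
      · rw [max_eq_right (by linarith)]
        simp
        ring
      · intro x hx
        rw [Set.uIcc_of_le h] at hx
        simp only
        rw [abs_of_nonneg (hδ.trans hx.1), max_eq_right]
        linarith [hx.1]
      · intro x hx
        rw [Set.uIcc_of_le hδ] at hx
        simp only
        rw [abs_of_nonneg hx.1, max_eq_left]
        linarith [hx.2]
  have key' : ∫ x in (-a)..0, max 0 (|x| - δ) = (max 0 (a - δ)) ^ 2 / 2 := by
    rw [← key]
    have := intervalIntegral.integral_comp_neg (a := 0) (b := a) fun x : ℝ => max 0 (|x| - δ)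
    simpa using this.symm
  rw [intervalIntegral.integral_sub (by simp) (hc.intervalIntegrable _ _),
    ← intervalIntegral.integral_add_adjacent_intervals (b := 0)
        (hc.intervalIntegrable (-a) _) (hc.intervalIntegrable _ a), key, key',
    intervalIntegral.integral_const, smul_eq_mul]
  ring

theorem triangleProb_eq {a b c : ℝ} (ha0 : 0 ≤ a) (hb0 : 0 ≤ b) (hc0 : 0 ≤ c) (ha : a ≤ 1 / 3)
    (hb : b ≤ 1 / 3) (hc : c ≤ 1 / 3) (habc : a ≤ b + c) :
    triangleProb a b c = 4 * a * min b c - (max 0 (a - |b - c|)) ^ 2 := by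
  have hi := integrable_triangleKernel a b c
  rw [Measure.volume_eq_prod] at hi
  rw [triangleProb, Measure.volume_eq_prod, integral_prod _ hi,
    ← UnitAddCircle.integral_preimage (-(1 / 2))]
  have h1 : ∀ᵐ x : ℝ, x ∈ Set.Ioc (-(1 / 2) : ℝ) (-(1 / 2) + 1) →
      ∫ z : UnitAddCircle, triangleKernel a b c x z =
        (Set.Ioc (-a) a).indicator (fun x => 2 * min b c - max 0 (|x| - |b - c|)) x := by
    -- The inner integral is known for `|x| < a` only; the endpoints are null.
    filter_upwards [Measure.ae_ne volume a, Measure.ae_ne volume (-a)] with x hx1 hx2 hx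
    by_cases hxa : x ∈ Set.Ioc (-a) a
    · rw [Set.indicator_of_mem hxa, integral_triangleKernel_right ha hb0 hb hc habc hc0]
      exact abs_lt.2 ⟨hxa.1, hxa.2.lt_of_ne hx1⟩
    · rw [Set.indicator_of_notMem hxa]
      have : ¬ ‖(x : UnitAddCircle)‖ ≤ a := by
        have hx' : |x| ≤ 1 / 2 := abs_le.2 ⟨by linarith [hx.1], by linarith [hx.2]⟩
        rw [norm_coe_unitAddCircle_eq_min (by linarith), min_eq_left (by linarith)]
        intro h
        rw [abs_le] at h
        exact hxa ⟨lt_of_le_of_ne h.1 (Ne.symm hx2), h.2⟩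
      simp [triangleKernel, this]
  rw [setIntegral_congr_ae measurableSet_Ioc h1, integral_indicator measurableSet_Ioc,
    Measure.restrict_restrict measurableSet_Ioc, Set.inter_eq_left.2,
    ← intervalIntegral.integral_of_le (by linarith), integral_abs_sub_pos ha0 (abs_nonneg _)]
  · ring
  · exact Set.Ioc_subset_Ioc (by linarith) (by linarith)

/-! ### Variance of a double sum over independent variables -/

theorem integral_mul_mul_le_of_iIndepFun {ι Ω : Type*} [DecidableEq ι] [MeasurableSpace Ω] {P : Measure Ω}
    [IsProbabilityMeasure P] {b : ι → Ω → ℝ} (hb : ∀ j, Measurable (b j)) (hind : iIndepFun b P)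
    (h0 : ∀ j ω, 0 ≤ b j ω) (h1 : ∀ j ω, b j ω ≤ 1) {β : ℝ} (hβ : ∀ j, ∫ ω, b j ω ∂P ≤ β)
    {j k m : ι} (hjk : j ≠ k) (hjm : j ≠ m) :
    ∫ ω, b j ω * b k ω * b m ω ∂P ≤ β ^ 3 + if k = m then β ^ 2 else 0 := by
  have hnn : ∀ j, 0 ≤ ∫ ω, b j ω ∂P := fun j => integral_nonneg (h0 j)
  have hβ0 : 0 ≤ β := (hnn j).trans (hβ j)
  have h2 : ∫ ω, b j ω * b k ω ∂P ≤ β ^ 2 := by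
    have := (hind.indepFun hjk).integral_mul_eq_mul_integral (hb j).aestronglyMeasurable
      (hb k).aestronglyMeasurable
    simp only [Pi.mul_apply] at this
    rw [this, sq]
    exact mul_le_mul (hβ j) (hβ k) (hnn k) hβ0
  have hb2 : ∀ j k ω, b j ω * b k ω ≤ 1 := fun j k ω => mul_le_one₀ (h1 j ω) (h0 k ω) (h1 k ω)
  have hb3 : ∀ j k m ω, b j ω * b k ω * b m ω ≤ 1 := fun j k m ω =>
    mul_le_one₀ (hb2 j k ω) (h0 m ω) (h1 m ω)
  by_cases hkm : k = m
  · subst hkm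
    rw [if_pos rfl]
    have : ∫ ω, b j ω * b k ω * b k ω ∂P ≤ ∫ ω, b j ω * b k ω ∂P := by
      refine integral_mono_of_nonneg (ae_of_all _ fun ω => ?_) ?_ (ae_of_all _ fun ω => ?_)
      · exact mul_nonneg (mul_nonneg (h0 j ω) (h0 k ω)) (h0 k ω)
      · refine Integrable.of_bound (((hb j).mul (hb k)).aestronglyMeasurable) 1
          (ae_of_all _ fun ω => ?_)
        rw [Real.norm_of_nonneg (mul_nonneg (h0 j ω) (h0 k ω))]
        exact hb2 j k ω
      · exact mul_le_of_le_one_right (mul_nonneg (h0 j ω) (h0 k ω)) (h1 k ω)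
    have : 0 ≤ β ^ 3 := by positivity
    linarith
  · rw [if_neg hkm, add_zero]
    have := (hind.indepFun_mul_left hb j k m hjm hkm).integral_mul_eq_mul_integral
      ((hb j).mul (hb k)).aestronglyMeasurable (hb m).aestronglyMeasurable
    simp only [Pi.mul_apply] at this
    rw [this, pow_succ]
    exact mul_le_mul h2 (hβ m) (hnn m) (by positivity)

/-- Only pairs with a common index are correlated. One shared index leaves three independent factors
`g`, hence `β ^ 3`; two shared indices leave two factors, hence `β ^ 2`. The factor 4 counts the
positions a shared index can take in the two pairs. -/
theorem variance_sum_sum_kernel_le {ι Ω E : Type*} [Fintype ι] [MeasurableSpace Ω]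
    [MeasurableSpace E] {P : Measure Ω} [IsProbabilityMeasure P] {Y : ι → Ω → E}
    (hY : ∀ j, Measurable (Y j)) (hind : iIndepFun Y P) {h : ι → ι → E → E → ℝ}
    (hh : ∀ j k, Measurable fun p : E × E => h j k p.1 p.2) (hdiag : ∀ j y z, h j j y z = 0)
    {g : E → ℝ} (hg : Measurable g) (hg0 : ∀ y, 0 ≤ g y) (hg1 : ∀ y, g y ≤ 1)
    (h0 : ∀ j k y z, 0 ≤ h j k y z) (h1 : ∀ j k y z, h j k y z ≤ g y * g z)
    {β : ℝ} (hβ : ∀ j, ∫ ω, g (Y j ω) ∂P ≤ β) :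
    Var[fun ω => ∑ j, ∑ k, h j k (Y j ω) (Y k ω); P] ≤
      4 * ((Fintype.card ι : ℝ) ^ 3 * β ^ 3 + (Fintype.card ι : ℝ) ^ 2 * β ^ 2) := by
  classical
  set Z : ι × ι → Ω → ℝ := fun p ω => h p.1 p.2 (Y p.1 ω) (Y p.2 ω) with hZ
  have hZm : ∀ p, Measurable (Z p) := fun p =>
    (hh p.1 p.2).comp ((hY p.1).prodMk (hY p.2))
  have hg2 : ∀ y z, g y * g z ≤ 1 := fun y z => mul_le_one₀ (hg1 y) (hg0 z) (hg1 z)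
  have hZ1 : ∀ p ω, Z p ω ≤ 1 := fun p ω => (h1 _ _ _ _).trans (hg2 _ _)
  have hZ0 : ∀ p ω, 0 ≤ Z p ω := fun p ω => h0 _ _ _ _
  have hZL : ∀ p, MemLp (Z p) 2 P := fun p =>
    MemLp.of_bound (hZm p).aestronglyMeasurable 1 (ae_of_all _ fun ω => by
      rw [Real.norm_of_nonneg (hZ0 p ω)]; exact hZ1 p ω)
  set b : ι → Ω → ℝ := fun j ω => g (Y j ω) with hbdef
  have hbm : ∀ j, Measurable (b j) := fun j => hg.comp (hY j)
  have hbind : iIndepFun b P := hind.comp (fun _ => g) (fun _ => hg)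
  have hbpos : ∀ j ω, 0 ≤ b j ω := fun j ω => hg0 _
  have hb1 : ∀ j ω, b j ω ≤ 1 := fun j ω => hg1 _
  -- `i` and `i'` are the slots tested for a coincidence; `k` and `m` are the remaining ones.
  let B : ι → ι → ι → ι → ℝ := fun i i' k m =>
    if i = i' then β ^ 3 + (if k = m then β ^ 2 else 0) else 0
  have hBnn : ∀ i i' k m, 0 ≤ β → 0 ≤ B i i' k m := by
    intro i i' k m hβ; simp only [B]; split_ifs <;> positivity
  have main : ∀ (j k m : ι) (p q : ι × ι), j ≠ k → j ≠ m →
      (∀ ω, Z p ω ≤ b j ω * b k ω) → (∀ ω, Z q ω ≤ b j ω * b m ω) →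
      cov[Z p, Z q; P] ≤ β ^ 3 + (if k = m then β ^ 2 else 0) := by
    intro j k m p q hjk hjm hp hq
    refine le_trans ?_ (integral_mul_mul_le_of_iIndepFun hbm hbind hbpos hb1 hβ hjk hjm)
    -- The product of the means is nonnegative, so it may be dropped.
    rw [covariance_eq_sub (hZL p) (hZL q)]
    have e1 : 0 ≤ (∫ ω, Z p ω ∂P) * ∫ ω, Z q ω ∂P :=
      mul_nonneg (integral_nonneg (hZ0 p)) (integral_nonneg (hZ0 q))
    have e2 : ∫ ω, (Z p * Z q) ω ∂P ≤ ∫ ω, b j ω * b k ω * b m ω ∂P := by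
      refine integral_mono_of_nonneg (ae_of_all _ fun ω => mul_nonneg (hZ0 p ω) (hZ0 q ω)) ?_
        (ae_of_all _ fun ω => ?_)
      · refine Integrable.of_bound
          (((hbm j).mul (hbm k)).mul (hbm m)).aestronglyMeasurable 1 (ae_of_all _ fun ω => ?_)
        rw [Real.norm_of_nonneg (mul_nonneg (mul_nonneg (hbpos j ω) (hbpos k ω)) (hbpos m ω))]
        exact mul_le_one₀ (hg2 _ _) (hbpos m ω) (hb1 m ω)
      · exact mul_le_mul (hp ω) ((hq ω).trans (mul_le_of_le_one_left (hbpos m ω) (hb1 j ω)))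
          (hZ0 q ω) (mul_nonneg (hbpos j ω) (hbpos k ω))
    linarith
  have hcov : ∀ p q : ι × ι, cov[Z p, Z q; P] ≤
      B p.1 q.1 p.2 q.2 + B p.1 q.2 p.2 q.1 + B p.2 q.1 p.1 q.2 + B p.2 q.2 p.1 q.1 := by
    rintro ⟨j, k⟩ ⟨l, m⟩
    have hβ0 : 0 ≤ β := (integral_nonneg (hbpos j)).trans (hβ j)
    have n1 := hBnn j l k m hβ0
    have n2 := hBnn j m k l hβ0
    have n3 := hBnn k l j m hβ0
    have n4 := hBnn k m j l hβ0
    have hzero : ∀ j, Z (j, j) = 0 := fun j => by ext ω; exact hdiag _ _ _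
    have hle : ∀ j k ω, Z (j, k) ω ≤ b j ω * b k ω := fun j k ω => h1 _ _ _ _
    have hle' : ∀ j k ω, Z (j, k) ω ≤ b k ω * b j ω := fun j k ω => by
      rw [mul_comm]; exact h1 _ _ _ _
    dsimp only
    by_cases hjk : j = k
    · subst hjk
      rw [hzero, covariance_zero_left]
      positivity
    by_cases hlm : l = m
    · subst hlm
      rw [hzero, covariance_zero_right]
      positivity
    by_cases c1 : j = l
    · subst c1
      have := main j k m (j, k) (j, m) hjk hlm (hle _ _) (hle _ _)
      have e : B j j k m = β ^ 3 + (if k = m then β ^ 2 else 0) := if_pos rfl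
      linarith
    by_cases c2 : j = m
    · subst c2
      have := main j k l (j, k) (l, j) hjk (Ne.symm hlm) (hle _ _) (hle' _ _)
      have e : B j j k l = β ^ 3 + (if k = l then β ^ 2 else 0) := if_pos rfl
      linarith
    by_cases c3 : k = l
    · subst c3
      have := main k j m (j, k) (k, m) (Ne.symm hjk) hlm (hle' _ _) (hle _ _)
      have e : B k k j m = β ^ 3 + (if j = m then β ^ 2 else 0) := if_pos rfl
      linarith
    by_cases c4 : k = m
    · subst c4
      have := main k j l (j, k) (l, k) (Ne.symm hjk) (Ne.symm hlm) (hle' _ _) (hle' _ _)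
      have e : B k k j l = β ^ 3 + (if j = l then β ^ 2 else 0) := if_pos rfl
      linarith
    have hI : IndepFun (Z (j, k)) (Z (l, m)) P :=
      (hind.indepFun_prodMk_prodMk hY j k l m c1 c2 c3 c4).comp (hh j k) (hh l m)
    rw [hI.covariance_eq_zero (hZL _) (hZL _)]
    positivity
  have hsum : (fun ω => ∑ j, ∑ k, h j k (Y j ω) (Y k ω)) = ∑ p, Z p := by
    ext ω
    rw [Finset.sum_apply, Fintype.sum_prod_type]
  rw [hsum, variance_sum hZL]
  refine (Finset.sum_le_sum fun p _ => Finset.sum_le_sum fun q _ => hcov p q).trans (le_of_eq ?_)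
  simp only [B, Finset.sum_add_distrib, Fintype.sum_prod_type, Finset.sum_ite_eq,
    Finset.mem_univ, if_true, Finset.sum_const, Finset.card_univ, nsmul_eq_mul,
    Finset.sum_ite_irrel, mul_zero, Fintype.card_prod, Nat.cast_mul]
  ring

/-! ### First and second moments of rooted counts -/

theorem triangleKernel_le_mul {a b c s : ℝ} (ha : a ≤ s) (hb : b ≤ s) (y z : UnitAddCircle) :
    triangleKernel a b c y z ≤ (if ‖y‖ ≤ s then 1 else 0) * (if ‖z‖ ≤ s then 1 else 0) := by
  unfold triangleKernel
  split_ifs with h1 h2 h3 h3 <;> norm_num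
  · exact h3 (h1.2.1.trans hb)
  · exact h2 (h1.1.trans ha)
  · exact h2 (h1.1.trans ha)

theorem triangleProb_nonneg (a b c : ℝ) : 0 ≤ triangleProb a b c :=
  integral_nonneg fun _ => triangleKernel_nonneg ..

theorem triangleProb_le {a b c s : ℝ} (ha : a ≤ s) (hb : b ≤ s) (hs0 : 0 ≤ s) (hs : s ≤ 1 / 2) :
    triangleProb a b c ≤ 4 * s ^ 2 := by
  rw [show 4 * s ^ 2 = (2 * s) * (2 * s) by ring,
    ← triangleProb_of_one_half_le hs0 hs hs0 hs le_rfl]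
  refine integral_mono (integrable_triangleKernel ..) (integrable_triangleKernel ..) fun p => ?_
  unfold triangleKernel
  have h1 := norm_unitAddCircle_le_half (p.1 - p.2)
  split_ifs with h h'
  · rfl
  · exact absurd ⟨h.1.trans ha, h.2.1.trans hb, h1⟩ h'
  · exact zero_le_one
  · rfl

/-- The kernel counting the triangles through a root `i` placed at the origin of the circle, the
vertex `j` being joined to `i` within distance `r j` and to `k` within distance `R j k`. -/
def rootedKernel {ι : Type*} [DecidableEq ι] (i : ι) (r : ι → ℝ) (R : ι → ι → ℝ) (j k : ι)
    (y z : UnitAddCircle) : ℝ :=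
  if j ≠ i ∧ k ≠ i ∧ j ≠ k then triangleKernel (r j) (r k) (R j k) y z else 0

section Rooted

variable {ι : Type*} [DecidableEq ι] (i : ι) (r : ι → ℝ) (R : ι → ι → ℝ)

theorem rootedKernel_nonneg (j k : ι) (y z : UnitAddCircle) : 0 ≤ rootedKernel i r R j k y z := by
  unfold rootedKernel
  split_ifs
  exacts [triangleKernel_nonneg .., le_rfl]

theorem measurable_rootedKernel (j k : ι) :
    Measurable fun p : UnitAddCircle × UnitAddCircle => rootedKernel i r R j k p.1 p.2 := by
  unfold rootedKernel
  split_ifs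
  exacts [measurable_triangleKernel .., measurable_const]

theorem measurable_rootedKernel_comp {α : Type*} [MeasurableSpace α] {f g : α → UnitAddCircle}
    (hf : Measurable f) (hg : Measurable g) (j k : ι) :
    Measurable fun x => rootedKernel i r R j k (f x) (g x) := by
  have h := (measurable_rootedKernel i r R j k).comp (hf.prodMk hg)
  exact h

theorem rootedKernel_le_mul {s : ℝ} (hr : ∀ j, r j ≤ s) (j k : ι) (y z : UnitAddCircle) :
    rootedKernel i r R j k y z ≤ (if ‖y‖ ≤ s then 1 else 0) * (if ‖z‖ ≤ s then 1 else 0) := by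
  unfold rootedKernel
  by_cases h : j ≠ i ∧ k ≠ i ∧ j ≠ k
  · rw [if_pos h]
    exact triangleKernel_le_mul (hr j) (hr k) y z
  · rw [if_neg h]
    positivity

theorem rootedKernel_le_one (j k : ι) (y z : UnitAddCircle) : rootedKernel i r R j k y z ≤ 1 := by
  unfold rootedKernel
  split_ifs
  exacts [triangleKernel_le_one .., zero_le_one]

variable [Fintype ι]

/-- The number of ordered pairs forming a triangle with the root `i`, see `rootedKernel`. -/
def rootedCount (y : ι → UnitAddCircle) : ℝ :=
  ∑ j, ∑ k, rootedKernel i r R j k (y j) (y k)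

theorem measurable_rootedCount : Measurable (rootedCount i r R) := by
  unfold rootedCount
  exact Finset.measurable_fun_sum _ fun j _ => Finset.measurable_fun_sum _ fun k _ =>
    measurable_rootedKernel_comp i r R (measurable_pi_apply j) (measurable_pi_apply k) j k

theorem rootedCount_nonneg (y : ι → UnitAddCircle) : 0 ≤ rootedCount i r R y :=
  Finset.sum_nonneg fun _ _ => Finset.sum_nonneg fun _ _ => rootedKernel_nonneg ..

theorem rootedCount_le_card_sq (y : ι → UnitAddCircle) :
    rootedCount i r R y ≤ (Fintype.card ι : ℝ) ^ 2 := by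
  calc rootedCount i r R y ≤ ∑ _j : ι, ∑ _k : ι, (1 : ℝ) :=
        Finset.sum_le_sum fun _ _ => Finset.sum_le_sum fun _ _ => rootedKernel_le_one ..
    _ = _ := by simp [sq]

/-- Circle distances never exceed `1 / 2`, so `R'` imposes nothing on the closing edge and the right
side counts all wedges at `i`. This is `T ≤ S`. -/
theorem rootedCount_le_of_one_half_le {R' : ι → ι → ℝ} (hR' : ∀ j k, 1 / 2 ≤ R' j k)
    (y : ι → UnitAddCircle) : rootedCount i r R y ≤ rootedCount i r R' y := by
  refine Finset.sum_le_sum fun j _ => Finset.sum_le_sum fun k _ => ?_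
  unfold rootedKernel triangleKernel
  have h1 := (norm_unitAddCircle_le_half (y j - y k)).trans (hR' j k)
  split_ifs with h h' h''
  · rfl
  · exact absurd ⟨h'.1, h'.2.1, h1⟩ h''
  · exact zero_le_one
  · rfl
  · rfl

variable {Ω : Type*} [MeasurableSpace Ω] {P : Measure Ω} [IsProbabilityMeasure P]
  {Y : ι → Ω → UnitAddCircle}

theorem integral_rootedCount (hY : ∀ j, Measurable (Y j)) (hind : iIndepFun Y P)
    (hlaw : ∀ j, P.map (Y j) = volume) :
    ∫ ω, rootedCount i r R (fun j => Y j ω) ∂P =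
      ∑ j, ∑ k, if j ≠ i ∧ k ≠ i ∧ j ≠ k then triangleProb (r j) (r k) (R j k) else 0 := by
  have hm : ∀ j k, Measurable fun ω => rootedKernel i r R j k (Y j ω) (Y k ω) := fun j k =>
    measurable_rootedKernel_comp i r R (hY j) (hY k) j k
  have hi : ∀ j k, Integrable (fun ω => rootedKernel i r R j k (Y j ω) (Y k ω)) P := fun j k => by
    refine Integrable.of_bound (hm j k).aestronglyMeasurable 1 (ae_of_all _ fun ω => ?_)
    rw [Real.norm_of_nonneg (rootedKernel_nonneg ..)]
    exact rootedKernel_le_one ..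
  unfold rootedCount
  rw [integral_finsetSum _ fun j _ => integrable_finsetSum _ fun k _ => hi j k]
  refine Finset.sum_congr rfl fun j _ => ?_
  rw [integral_finsetSum _ fun k _ => hi j k]
  refine Finset.sum_congr rfl fun k _ => ?_
  by_cases h : j ≠ i ∧ k ≠ i ∧ j ≠ k
  · simp only [rootedKernel, if_pos h]
    have h2 := (indepFun_iff_map_prod_eq_prod_map_map (hY j).aemeasurable
      (hY k).aemeasurable).1 (hind.indepFun h.2.2)
    rw [hlaw, hlaw, ← Measure.volume_eq_prod] at h2
    rw [triangleProb, ← h2, integral_map ((hY j).prodMk (hY k)).aemeasurable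
      (measurable_triangleKernel ..).aestronglyMeasurable]
  · simp only [rootedKernel, if_neg h, integral_zero]

/-- The sums differ on the diagonals `j = i`, `k = i` and `j = k` only, each with `card ι` terms of
size at most `4 * s ^ 2`. -/
theorem abs_integral_rootedCount_sub_le (hY : ∀ j, Measurable (Y j)) (hind : iIndepFun Y P)
    (hlaw : ∀ j, P.map (Y j) = volume) {s : ℝ} (hs0 : 0 ≤ s) (hs : s ≤ 1 / 2)
    (hr : ∀ j, r j ≤ s) :
    |(∫ ω, rootedCount i r R (fun j => Y j ω) ∂P) -
        ∑ j, ∑ k, triangleProb (r j) (r k) (R j k)| ≤ 12 * Fintype.card ι * s ^ 2 := by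
  rw [integral_rootedCount i r R hY hind hlaw, abs_sub_comm, ← Finset.sum_sub_distrib]
  simp only [← Finset.sum_sub_distrib]
  have h1 : ∀ j k, |triangleProb (r j) (r k) (R j k) -
      (if j ≠ i ∧ k ≠ i ∧ j ≠ k then triangleProb (r j) (r k) (R j k) else 0)| ≤
      (if j = i then 4 * s ^ 2 else 0) + (if k = i then 4 * s ^ 2 else 0) +
        (if j = k then 4 * s ^ 2 else 0) := by
    intro j k
    have h2 := triangleProb_le (c := R j k) (hr j) (hr k) hs0 hs
    have h3 := triangleProb_nonneg (r j) (r k) (R j k)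
    have h4 : 0 ≤ 4 * s ^ 2 := by positivity
    by_cases h : j ≠ i ∧ k ≠ i ∧ j ≠ k
    · rw [if_pos h, sub_self, abs_zero]
      positivity
    · rw [if_neg h, sub_zero, abs_of_nonneg h3]
      split_ifs <;> first | linarith | tauto
  refine (Finset.abs_sum_le_sum_abs _ _).trans ((Finset.sum_le_sum fun j _ =>
    (Finset.abs_sum_le_sum_abs _ _).trans (Finset.sum_le_sum fun k _ => h1 j k)).trans
      (le_of_eq ?_))
  simp only [Finset.sum_add_distrib, Finset.sum_ite_eq, Finset.sum_ite_eq', Finset.mem_univ,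
    if_true, Finset.sum_const, Finset.card_univ, nsmul_eq_mul, mul_ite, mul_zero]
  ring

/-- Nonnegativity of the variance of `|T - t|` bounds its squared mean by the second moment, which
splits into variance and squared bias. -/
theorem integral_abs_sub_le_sqrt {T : Ω → ℝ} (hT : MemLp T 2 P) (t : ℝ) :
    ∫ ω, |T ω - t| ∂P ≤ √(Var[T; P] + ((∫ ω, T ω ∂P) - t) ^ 2) := by
  have hTt : MemLp (fun ω => T ω - t) 2 P := hT.sub (memLp_const t)
  have h1 := variance_nonneg (fun ω => |T ω - t|) P
  have habs : MemLp (fun ω => |T ω - t|) 2 P := hTt.abs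
  rw [variance_eq_sub habs] at h1
  have h2 := variance_eq_sub hTt
  rw [variance_sub_const hT.aestronglyMeasurable] at h2
  simp only [Pi.pow_apply, sq_abs] at h1 h2
  rw [integral_sub (hT.integrable (by norm_num)) (integrable_const _)] at h2
  simp only [integral_const, probReal_univ, one_smul] at h2
  refine Real.le_sqrt_of_sq_le ?_
  linarith

theorem integral_abs_rootedCount_sub_le (hY : ∀ j, Measurable (Y j)) (hind : iIndepFun Y P)
    (hlaw : ∀ j, P.map (Y j) = volume) {s : ℝ} (hs0 : 0 ≤ s) (hs : s ≤ 1 / 2)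
    (hr : ∀ j, r j ≤ s) {t : ℝ}
    (ht : |(∑ j, ∑ k, triangleProb (r j) (r k) (R j k)) - t| ≤ 4 * Fintype.card ι * s ^ 2) :
    ∫ ω, |rootedCount i r R (fun j => Y j ω) - t| ∂P ≤
      √(4 * (8 * (Fintype.card ι * s) ^ 3 + 4 * (Fintype.card ι * s) ^ 2) +
        (16 * Fintype.card ι * s ^ 2) ^ 2) := by
  have hm : Measurable fun ω => rootedCount i r R (fun j => Y j ω) :=
    (measurable_rootedCount i r R).comp (measurable_pi_lambda _ hY)
  have hL : MemLp (fun ω => rootedCount i r R (fun j => Y j ω)) 2 P :=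
    MemLp.of_bound hm.aestronglyMeasurable ((Fintype.card ι : ℝ) ^ 2) (ae_of_all _ fun ω => by
      rw [Real.norm_of_nonneg (rootedCount_nonneg ..)]
      exact rootedCount_le_card_sq ..)
  have hgm : Measurable fun y : UnitAddCircle => if ‖y‖ ≤ s then (1 : ℝ) else 0 :=
    Measurable.ite (measurableSet_le measurable_norm measurable_const) measurable_const
      measurable_const
  have hV := variance_sum_sum_kernel_le hY hind (h := rootedKernel i r R)
    (g := fun y => if ‖y‖ ≤ s then 1 else 0) (β := 2 * s) (measurable_rootedKernel i r R)
    (fun j y z => by simp [rootedKernel]) hgm (fun y => by positivity)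
    (fun y => by split_ifs <;> norm_num) (rootedKernel_nonneg i r R)
    (rootedKernel_le_mul i r R hr)
    (fun j => le_of_eq (by
      rw [← integral_indicator_norm_le hs0 hs, ← hlaw j,
        integral_map (hY j).aemeasurable hgm.aestronglyMeasurable]))
  -- The variance bound enters with `β = 2 * s`; the bias constant is `16 = 12 + 4`, from the
  -- diagonals and from `ht`.
  refine (integral_abs_sub_le_sqrt hL t).trans (Real.sqrt_le_sqrt (add_le_add ?_ ?_))
  · refine hV.trans (le_of_eq ?_)
    ring
  · refine sq_le_sq' ?_ ?_ <;>
    linarith [abs_le.1 (abs_integral_rootedCount_sub_le i r R hY hind hlaw hs0 hs hr), abs_le.1 ht]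

end Rooted

/-! ### Communities and the clustering coefficient of one vertex -/

/-- If `S` is off by at least `s / 2`, the right side is at least 1 while both ratios lie in `[0,
1]`; otherwise `S > s / 2` and the difference can be expanded. Thus `S` needs no lower bound, and `S
= 0` is covered by `T / 0 = 0`. -/
theorem abs_div_sub_div_le {T S t s : ℝ} (hT : 0 ≤ T) (hTS : T ≤ S) (ht : 0 ≤ t) (hts : t ≤ s)
    (hs : 0 < s) : |T / S - t / s| ≤ 2 * (|T - t| + |S - s|) / s := by
  rw [le_div_iff₀ hs]
  rcases le_or_gt (s / 2) |S - s| with h | h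
  · have h1 : T / S ≤ 1 := div_le_one_of_le₀ hTS (hT.trans hTS)
    have h2 : t / s ≤ 1 := div_le_one_of_le₀ hts hs.le
    have h3 : 0 ≤ T / S := div_nonneg hT (hT.trans hTS)
    have h4 : 0 ≤ t / s := div_nonneg ht hs.le
    have h5 : |T / S - t / s| ≤ 1 := abs_le.2 ⟨by linarith, by linarith⟩
    nlinarith [abs_nonneg (T - t)]
  · have hS : s / 2 < S := by linarith [(abs_lt.1 h).1]
    have hS0 : 0 < S := by linarith
    have e : T / S - t / s = ((T - t) - (t / s) * (S - s)) / S := by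
      field_simp; ring
    have h2 : t / s ≤ 1 := div_le_one_of_le₀ hts hs.le
    have h4 : 0 ≤ t / s := div_nonneg ht hs.le
    have h6 : |(T - t) - (t / s) * (S - s)| ≤ |T - t| + |S - s| := by
      refine (abs_sub _ _).trans (add_le_add_right ?_ _)
      rw [abs_mul, abs_of_nonneg h4]
      exact mul_le_of_le_one_left (abs_nonneg _) h2
    rw [e, abs_div, abs_of_pos hS0, div_mul_eq_mul_div, div_le_iff₀ hS0]
    nlinarith [abs_nonneg (T - t), abs_nonneg (S - s)]

/-- The probability, for `d ≤ s ≤ 1 / 3`, that two uniform points of the circle form a triangle with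
the origin when one pair of the three is connected within distance `s` and the other two pairs
within distance `d`. -/
def mixedTriangleProb (s d : ℝ) : ℝ := 4 * d ^ 2 - (max 0 (2 * d - s)) ^ 2

/-- The limiting clustering coefficient of a vertex whose community has proportion `ρ`. -/
def clusteringConst (ρ s d : ℝ) : ℝ :=
  (3 * ρ ^ 2 * s ^ 2 + (1 - ρ ^ 2) * mixedTriangleProb s d) / (4 * (ρ * s + (1 - ρ) * d) ^ 2)

theorem mixedTriangleProb_nonneg {s d : ℝ} (hd : 0 ≤ d) (hds : d ≤ s) :
    0 ≤ mixedTriangleProb s d := by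
  unfold mixedTriangleProb
  rcases max_cases 0 (2 * d - s) with ⟨h, _⟩ | ⟨h, _⟩ <;> rw [h] <;> nlinarith

theorem mixedTriangleProb_le (s d : ℝ) : mixedTriangleProb s d ≤ 4 * d ^ 2 := by
  unfold mixedTriangleProb
  linarith [sq_nonneg (max 0 (2 * d - s))]

/-- `p` and `p'` say whether each of the two vertices shares the community of the root. With two
communities, either all three vertices agree or exactly one pair does. -/
theorem triangleProb_community {s d : ℝ} (hd : 0 ≤ d) (hds : d ≤ s) (hs : s ≤ 1 / 3) (p p' : Prop)
    [Decidable p] [Decidable p'] [Decidable (p ↔ p')] :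
    triangleProb (if p then s else d) (if p' then s else d) (if p ↔ p' then s else d) =
      if p ∧ p' then 3 * s ^ 2 else mixedTriangleProb s d := by
  have hs0 := hd.trans hds
  have hd3 := hds.trans hs
  have h1 : triangleProb s s s = 3 * s ^ 2 := by
    rw [triangleProb_eq hs0 hs0 hs0 hs hs hs (by linarith)]
    simp [hs0]
    ring
  have h2 : triangleProb d s d = mixedTriangleProb s d := by
    rw [triangleProb_eq hd hs0 hd hd3 hs hd3 (by linarith), min_eq_right hds,
      abs_of_nonneg (by linarith), mixedTriangleProb]
    ring_nf
  have h3 : triangleProb d d s = mixedTriangleProb s d := by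
    rw [triangleProb_eq hd hd hs0 hd3 hd3 hs (by linarith), min_eq_left hds,
      abs_of_nonpos (by linarith), mixedTriangleProb]
    ring_nf
  by_cases hp : p <;> by_cases hp' : p' <;> simp only [hp, hp', if_true, if_false, and_self,
    and_true, and_false, iff_self, iff_false, iff_true, not_true_eq_false]
  · exact h1
  · rw [triangleProb_swap, h2]
  · exact h2
  · exact h3

section Community

variable {ι : Type*} [Fintype ι] (σ : ι → Prop) [DecidablePred σ]

theorem sum_ite_community (x y : ℝ) : ∑ j, (if σ j then x else y) =
    (Finset.univ.filter σ).card * x + (Fintype.card ι - (Finset.univ.filter σ).card) * y := by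
  have h := Finset.card_filter_add_card_filter_not (s := (Finset.univ : Finset ι)) σ
  rw [Finset.card_univ] at h
  rw [Finset.sum_ite, Finset.sum_const, Finset.sum_const, ← h]
  push_cast
  simp

theorem sum_sum_ite_community (x y : ℝ) : ∑ j, ∑ k, (if σ j ∧ σ k then x else y) =
    ((Finset.univ.filter σ).card : ℝ) ^ 2 * x +
      ((Fintype.card ι : ℝ) ^ 2 - ((Finset.univ.filter σ).card : ℝ) ^ 2) * y := by
  have h : ∀ j, ∑ k, (if σ j ∧ σ k then x else y) = if σ j then
      (Finset.univ.filter σ).card * x + (Fintype.card ι - (Finset.univ.filter σ).card) * y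
      else Fintype.card ι * y := by
    intro j
    by_cases hj : σ j
    · simp only [hj, true_and, if_true, sum_ite_community]
    · simp [hj]
  simp only [h]
  rw [sum_ite_community]
  ring

variable {σ}

/-- The discrepancy carries the factor `N ^ 2 - (ρ n) ^ 2 = (N - ρ n) (N + ρ n)`, so rounding the
community size costs a factor `n` instead of `n ^ 2`. -/
theorem abs_sum_triangleProb_sub_le {s d ρ : ℝ} (hd : 0 ≤ d) (hds : d ≤ s) (hs : s ≤ 1 / 3)
    (hρ0 : 0 ≤ ρ) (hρ1 : ρ ≤ 1)
    (hN : |((Finset.univ.filter σ).card : ℝ) - ρ * Fintype.card ι| ≤ 1 / 2) :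
    |(∑ j, ∑ k, triangleProb (if σ j then s else d) (if σ k then s else d)
        (if σ j ↔ σ k then s else d)) -
      (Fintype.card ι : ℝ) ^ 2 * (3 * ρ ^ 2 * s ^ 2 + (1 - ρ ^ 2) * mixedTriangleProb s d)| ≤
      4 * Fintype.card ι * s ^ 2 := by
  simp only [triangleProb_community hd hds hs]
  rw [sum_sum_ite_community]
  have hNn : ((Finset.univ.filter σ).card : ℝ) ≤ Fintype.card ι := by
    exact_mod_cast Finset.card_le_univ _
  have hN0 : (0 : ℝ) ≤ (Finset.univ.filter σ).card := by positivity
  set N : ℝ := ((Finset.univ.filter σ).card : ℝ)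
  set n : ℝ := (Fintype.card ι : ℝ)
  have hq0 := mixedTriangleProb_nonneg hd hds
  have hq1 := mixedTriangleProb_le s d
  set q := mixedTriangleProb s d
  have hds2 : d ^ 2 ≤ s ^ 2 := pow_le_pow_left₀ hd hds 2
  have hρn : ρ * n ≤ n := mul_le_of_le_one_left (hN0.trans hNn) hρ1
  have hρn0 : 0 ≤ ρ * n := mul_nonneg hρ0 (hN0.trans hNn)
  have e : N ^ 2 * (3 * s ^ 2) + (n ^ 2 - N ^ 2) * q -
      n ^ 2 * (3 * ρ ^ 2 * s ^ 2 + (1 - ρ ^ 2) * q) =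
      (N - ρ * n) * ((N + ρ * n) * (3 * s ^ 2 - q)) := by ring
  have h3 : |3 * s ^ 2 - q| ≤ 4 * s ^ 2 := abs_le.2 ⟨by nlinarith, by nlinarith⟩
  rw [e, abs_mul, abs_mul, abs_of_nonneg (show 0 ≤ N + ρ * n by linarith)]
  calc |N - ρ * n| * ((N + ρ * n) * |3 * s ^ 2 - q|) ≤ 1 / 2 * ((2 * n) * (4 * s ^ 2)) := by
        gcongr
        linarith
    _ = 4 * n * s ^ 2 := by ring

theorem abs_sum_wedgeProb_sub_le {s d ρ : ℝ} (hd : 0 ≤ d) (hds : d ≤ s) (hs : s ≤ 1 / 2)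
    (hρ0 : 0 ≤ ρ) (hρ1 : ρ ≤ 1)
    (hN : |((Finset.univ.filter σ).card : ℝ) - ρ * Fintype.card ι| ≤ 1 / 2) :
    |(∑ j, ∑ k, triangleProb (if σ j then s else d) (if σ k then s else d) 1) -
      (Fintype.card ι : ℝ) ^ 2 * (4 * (ρ * s + (1 - ρ) * d) ^ 2)| ≤
      4 * Fintype.card ι * s ^ 2 := by
  have hs0 := hd.trans hds
  have hr0 : ∀ j, 0 ≤ if σ j then s else d := fun j => by split_ifs <;> assumption
  have hr1 : ∀ j, (if σ j then s else d) ≤ 1 / 2 := fun j => by split_ifs <;> linarith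
  have h1 : ∀ j k, triangleProb (if σ j then s else d) (if σ k then s else d) 1 =
      (2 * if σ j then s else d) * (2 * if σ k then s else d) := fun j k =>
    triangleProb_of_one_half_le (hr0 j) (hr1 j) (hr0 k) (hr1 k) (by norm_num)
  simp only [h1, ← Finset.mul_sum, ← Finset.sum_mul]
  rw [sum_ite_community]
  have hNn : ((Finset.univ.filter σ).card : ℝ) ≤ Fintype.card ι := by
    exact_mod_cast Finset.card_le_univ _
  have hN0 : (0 : ℝ) ≤ (Finset.univ.filter σ).card := by positivity
  set N : ℝ := ((Finset.univ.filter σ).card : ℝ)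
  set n : ℝ := (Fintype.card ι : ℝ)
  have e : 2 * (N * s + (n - N) * d) * (2 * (N * s + (n - N) * d)) -
      n ^ 2 * (4 * (ρ * s + (1 - ρ) * d) ^ 2) =
      (N - ρ * n) * (4 * (s - d) * (N * s + (n - N) * d + n * (ρ * s + (1 - ρ) * d))) := by ring
  have hn0 := hN0.trans hNn
  have hsd : 0 ≤ s - d := by linarith
  have h5 : 0 ≤ N * s + (n - N) * d + n * (ρ * s + (1 - ρ) * d) := by
    have : 0 ≤ n - N := by linarith
    have : 0 ≤ 1 - ρ := by linarith
    positivity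
  have h6 : N * s + (n - N) * d + n * (ρ * s + (1 - ρ) * d) ≤ 2 * n * s := by
    have : ρ * s + (1 - ρ) * d ≤ s := by nlinarith
    nlinarith
  rw [e, abs_mul, abs_of_nonneg (show 0 ≤ 4 * (s - d) * _ from by positivity)]
  calc |N - ρ * n| * (4 * (s - d) * (N * s + (n - N) * d + n * (ρ * s + (1 - ρ) * d)))
      ≤ 1 / 2 * (4 * s * (2 * n * s)) := by
        gcongr
        linarith
    _ = 4 * n * s ^ 2 := by ring

variable [DecidableEq ι] {Ω : Type*} [MeasurableSpace Ω] {P : Measure Ω} [IsProbabilityMeasure P]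
  {Y : ι → Ω → UnitAddCircle}

theorem clusteringConst_num_nonneg {s d ρ : ℝ} (hd : 0 ≤ d) (hds : d ≤ s) (hρ0 : 0 ≤ ρ)
    (hρ1 : ρ ≤ 1) : 0 ≤ 3 * ρ ^ 2 * s ^ 2 + (1 - ρ ^ 2) * mixedTriangleProb s d := by
  have h1 : 0 ≤ 1 - ρ ^ 2 := by nlinarith
  have h2 := mixedTriangleProb_nonneg hd hds
  positivity

theorem clusteringConst_num_le_den {s d ρ : ℝ} (hd : 0 ≤ d) (hds : d ≤ s) (hρ0 : 0 ≤ ρ)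
    (hρ1 : ρ ≤ 1) : 3 * ρ ^ 2 * s ^ 2 + (1 - ρ ^ 2) * mixedTriangleProb s d ≤
      4 * (ρ * s + (1 - ρ) * d) ^ 2 := by
  have h1 : 0 ≤ 1 - ρ ^ 2 := by nlinarith
  have h2 : (1 - ρ ^ 2) * mixedTriangleProb s d ≤ (1 - ρ ^ 2) * (4 * d ^ 2) :=
    mul_le_mul_of_nonneg_left (mixedTriangleProb_le s d) h1
  -- After replacing the mixed probability by `4 * d ^ 2`, the gap is exactly `(ρ s) ^ 2 + 8 ρ (1 -
  -- ρ) d (s - d)`.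
  have h3 : 0 ≤ ρ * (1 - ρ) * (d * (s - d)) :=
    mul_nonneg (mul_nonneg hρ0 (by linarith)) (mul_nonneg hd (by linarith))
  nlinarith [sq_nonneg (ρ * s)]

theorem integral_abs_rootedCount_div_sub_le (i : ι) (hY : ∀ j, Measurable (Y j))
    (hind : iIndepFun Y P) (hlaw : ∀ j, P.map (Y j) = volume) {s d ρ : ℝ} (hd : 0 < d)
    (hds : d ≤ s) (hs : s ≤ 1 / 3) (hρ0 : 0 ≤ ρ) (hρ1 : ρ ≤ 1)
    (hN : |((Finset.univ.filter σ).card : ℝ) - ρ * Fintype.card ι| ≤ 1 / 2) :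
    ∫ ω, |rootedCount i (fun j => if σ j then s else d)
          (fun j k => if σ j ↔ σ k then s else d) (fun j => Y j ω) /
        rootedCount i (fun j => if σ j then s else d) (fun _ _ => 1) (fun j => Y j ω) -
        clusteringConst ρ s d| ∂P ≤
      √(4 * (8 * (Fintype.card ι * s) ^ 3 + 4 * (Fintype.card ι * s) ^ 2) +
        (16 * Fintype.card ι * s ^ 2) ^ 2) / (Fintype.card ι * d) ^ 2 := by
  set r : ι → ℝ := fun j => if σ j then s else d with hr
  set R : ι → ι → ℝ := fun j k => if σ j ↔ σ k then s else d with hR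
  set n : ℝ := (Fintype.card ι : ℝ) with hn
  have hn0 : 0 < n := by
    have : Nonempty ι := ⟨i⟩
    exact Nat.cast_pos.2 Fintype.card_pos
  set v := √(4 * (8 * (n * s) ^ 3 + 4 * (n * s) ^ 2) + (16 * n * s ^ 2) ^ 2)
  set t := n ^ 2 * (3 * ρ ^ 2 * s ^ 2 + (1 - ρ ^ 2) * mixedTriangleProb s d) with ht
  set s0 := n ^ 2 * (4 * (ρ * s + (1 - ρ) * d) ^ 2) with hs0
  have hmean : d ≤ ρ * s + (1 - ρ) * d := by nlinarith
  have hs0le : 4 * (n * d) ^ 2 ≤ s0 := by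
    have : d ^ 2 ≤ (ρ * s + (1 - ρ) * d) ^ 2 := pow_le_pow_left₀ hd.le hmean 2
    rw [hs0, mul_pow]
    nlinarith [sq_nonneg n]
  have hs0pos : 0 < s0 := lt_of_lt_of_le (by positivity) hs0le
  have hrs : ∀ j, r j ≤ s := fun j => by simp only [hr]; split_ifs <;> linarith
  have hT := integral_abs_rootedCount_sub_le i r R hY hind hlaw (hd.le.trans hds)
    (hs.trans (by norm_num)) hrs (t := t) (abs_sum_triangleProb_sub_le hd.le hds hs hρ0 hρ1 hN)
  have hS := integral_abs_rootedCount_sub_le i r (fun _ _ => 1) hY hind hlaw (hd.le.trans hds)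
    (hs.trans (by norm_num)) hrs (t := s0) (abs_sum_wedgeProb_sub_le hd.le hds
      (hs.trans (by norm_num)) hρ0 hρ1 hN)
  have hc : clusteringConst ρ s d = t / s0 := by
    rw [ht, hs0, mul_div_mul_left _ _ (by positivity)]; rfl
  have hint : ∀ (R : ι → ι → ℝ) (t : ℝ),
      Integrable (fun ω => |rootedCount i r R (fun j => Y j ω) - t|) P := by
    intro R t
    have hm : Measurable fun ω => rootedCount i r R (fun j => Y j ω) :=
      (measurable_rootedCount i r R).comp (measurable_pi_lambda _ hY)
    refine Integrable.abs (Integrable.sub (Integrable.of_bound hm.aestronglyMeasurable (n ^ 2)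
      (ae_of_all _ fun ω => ?_)) (integrable_const _))
    rw [Real.norm_of_nonneg (rootedCount_nonneg ..)]
    exact rootedCount_le_card_sq ..
  have hstep : ∫ ω, |rootedCount i r R (fun j => Y j ω) /
        rootedCount i r (fun _ _ => 1) (fun j => Y j ω) - clusteringConst ρ s d| ∂P ≤
      ∫ ω, 2 * (|rootedCount i r R (fun j => Y j ω) - t| +
        |rootedCount i r (fun _ _ => 1) (fun j => Y j ω) - s0|) / s0 ∂P := by
    refine integral_mono_of_nonneg (ae_of_all _ fun ω => abs_nonneg _)
      ((((hint R t).add (hint _ s0)).const_mul 2).div_const s0) (ae_of_all _ fun ω => ?_)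
    simp only [hc]
    refine abs_div_sub_div_le (rootedCount_nonneg ..)
      (rootedCount_le_of_one_half_le _ _ _ (fun _ _ => by norm_num) _) ?_ ?_ hs0pos
    · exact mul_nonneg (sq_nonneg n) (clusteringConst_num_nonneg hd.le hds hρ0 hρ1)
    · exact mul_le_mul_of_nonneg_left (clusteringConst_num_le_den hd.le hds hρ0 hρ1) (sq_nonneg n)
  refine hstep.trans ?_
  rw [integral_div, integral_const_mul, integral_add (hint R t) (hint _ s0)]
  have hv : 0 ≤ v := Real.sqrt_nonneg _
  calc 2 * ((∫ ω, |rootedCount i r R (fun j => Y j ω) - t| ∂P) +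
        ∫ ω, |rootedCount i r (fun _ _ => 1) (fun j => Y j ω) - s0| ∂P) / s0
      ≤ 2 * (v + v) / s0 := by gcongr
    _ ≤ 2 * (v + v) / (4 * (n * d) ^ 2) := by gcongr
    _ = v / (n * d) ^ 2 := by field_simp; ring

end Community

/-! ### Relative positions are independent and uniform -/

/-- The positions on the circle relative to that of the vertex `i`, whose own position is kept. -/
def relativePosition {ι : Type*} [DecidableEq ι] (i : ι) (u : ι → UnitAddCircle) (j : ι) :
    UnitAddCircle :=
  if j = i then u i else u j - u i

/-- The relative positions depend on the positions by a homomorphism. -/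
def relativePositionHom {ι : Type*} [DecidableEq ι] (i : ι) :
    (ι → UnitAddCircle) →+ (ι → UnitAddCircle) where
  toFun := relativePosition i
  map_zero' := by ext j; simp [relativePosition]
  map_add' u v := by
    ext j
    simp only [relativePosition, Pi.add_apply]
    split_ifs
    · rfl
    · abel

theorem continuous_relativePosition {ι : Type*} [DecidableEq ι] (i : ι) :
    Continuous (relativePosition i) := by
  refine continuous_pi fun j => ?_
  unfold relativePosition
  split_ifs <;> fun_prop

/-- A continuous surjective endomorphism of a compact group preserves normalised Haar measure.
Keeping `u i` as a coordinate is what makes the map surjective. -/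
theorem measurePreserving_relativePosition {ι : Type*} [Fintype ι] [DecidableEq ι] (i : ι) :
    MeasurePreserving (relativePosition i) (volume : Measure (ι → UnitAddCircle)) volume := by
  refine AddMonoidHom.measurePreserving (f := relativePositionHom i)
    (continuous_relativePosition i) (fun y => ?_) rfl
  refine ⟨fun j => if j = i then y i else y j + y i, ?_⟩
  ext j
  change relativePosition i (fun j => if j = i then y i else y j + y i) j = y j
  by_cases h : j = i <;> simp [relativePosition, h]

section Law

variable {ι Ω : Type*} [Fintype ι] [DecidableEq ι] [MeasurableSpace Ω] {P : Measure Ω}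

theorem ae_mem_Icc_of_isUniform {X : Ω → ℝ} (hX : Measurable X)
    (hunif : pdf.IsUniform X (Set.Icc (0 : ℝ) 1) P volume) :
    ∀ᵐ ω ∂P, X ω ∈ Set.Icc (0 : ℝ) 1 := by
  have h : ∀ᵐ x ∂(P.map X), x ∈ Set.Icc (0 : ℝ) 1 := by
    rw [hunif]
    exact ae_cond_mem measurableSet_Icc
  exact ae_of_ae_map hX.aemeasurable h

theorem map_coe_unitAddCircle_of_isUniform {X : Ω → ℝ} (hX : Measurable X)
    (hunif : pdf.IsUniform X (Set.Icc (0 : ℝ) 1) P volume) :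
    P.map (fun ω => (X ω : UnitAddCircle)) = volume := by
  have h1 : P.map X = volume.restrict (Set.Ioc (0 : ℝ) (0 + 1)) := by
    rw [hunif, ProbabilityTheory.cond, Real.volume_Icc, zero_add, restrict_Ioc_eq_restrict_Icc]
    simp
  have h2 := (UnitAddCircle.measurePreserving_mk 0).map_eq
  rw [← h1, Measure.map_map (UnitAddCircle.measurePreserving_mk 0).measurable hX] at h2
  exact h2

variable [IsProbabilityMeasure P]

theorem map_relativePosition {U : ι → Ω → UnitAddCircle} (hU : ∀ j, Measurable (U j))
    (hind : iIndepFun U P) (hlaw : ∀ j, P.map (U j) = volume) (i : ι) :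
    P.map (fun ω j => relativePosition i (fun k => U k ω) j) = volume := by
  have h1 := (iIndepFun_iff_map_fun_eq_pi_map fun j => (hU j).aemeasurable).1 hind
  simp only [hlaw] at h1
  have h2 := (measurePreserving_relativePosition i).map_eq
  rw [volume_pi, ← h1, Measure.map_map (measurePreserving_relativePosition i).measurable
    (measurable_pi_lambda _ hU)] at h2
  rw [volume_pi, ← h1]
  exact h2

theorem measurable_relativePosition {U : ι → Ω → UnitAddCircle} (hU : ∀ j, Measurable (U j))
    (i j : ι) : Measurable fun ω => relativePosition i (fun k => U k ω) j :=
  (measurable_pi_apply j).comp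
    ((measurePreserving_relativePosition i).measurable.comp (measurable_pi_lambda _ hU))

theorem map_relativePosition_apply {U : ι → Ω → UnitAddCircle} (hU : ∀ j, Measurable (U j))
    (hind : iIndepFun U P) (hlaw : ∀ j, P.map (U j) = volume) (i j : ι) :
    P.map (fun ω => relativePosition i (fun k => U k ω) j) = volume := by
  have h := (measurePreserving_eval (fun _ : ι => (volume : Measure UnitAddCircle)) j).map_eq
  rw [← volume_pi, ← map_relativePosition hU hind hlaw i, Measure.map_map (measurable_pi_apply j)
    (measurable_pi_lambda _ (measurable_relativePosition hU i))] at h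
  exact h

theorem iIndepFun_relativePosition {U : ι → Ω → UnitAddCircle} (hU : ∀ j, Measurable (U j))
    (hind : iIndepFun U P) (hlaw : ∀ j, P.map (U j) = volume) (i : ι) :
    iIndepFun (fun j ω => relativePosition i (fun k => U k ω) j) P := by
  refine (iIndepFun_iff_map_fun_eq_pi_map
    fun j => (measurable_relativePosition hU i j).aemeasurable).2 ?_
  simp only [map_relativePosition_apply hU hind hlaw i]
  exact map_relativePosition hU hind hlaw i

end Law

/-! ### From the graph to rooted counts -/

section Graph

variable {n : ℕ} (V : Finset (Fin n)) {s d : ℝ} {x : Fin n → ℝ}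

theorem gbmGraph_adj_iff (hx : ∀ j, x j ∈ Set.Icc (0 : ℝ) 1) (j k : Fin n) :
    (gbmGraph V s d x).Adj j k ↔
      j ≠ k ∧ ‖(x j : UnitAddCircle) - x k‖ ≤ if (j ∈ V ↔ k ∈ V) then s else d := by
  simp only [gbmGraph, circDist_eq_norm (hx j) (hx k)]
  split_ifs <;> simp

theorem avgClustering_gbmGraph (hx : ∀ j, x j ∈ Set.Icc (0 : ℝ) 1) :
    avgClustering (gbmGraph V s d x) = (1 / (n : ℝ)) * ∑ i,
      rootedCount i (fun j => if (i ∈ V ↔ j ∈ V) then s else d)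
          (fun j k => if (i ∈ V ↔ j ∈ V) ↔ (i ∈ V ↔ k ∈ V) then s else d)
          (relativePosition i fun j => x j) /
        rootedCount i (fun j => if (i ∈ V ↔ j ∈ V) then s else d) (fun _ _ => 1)
          (relativePosition i fun j => x j) := by
  classical
  rw [avgClustering, Fintype.card_fin]
  congr 1
  refine Finset.sum_congr rfl fun i _ => ?_
  set G := gbmGraph V s d x with hG
  have hadj : ∀ j, G.Adj i j ↔ j ≠ i ∧ ‖relativePosition i (fun j => (x j : UnitAddCircle)) j‖ ≤
      if (i ∈ V ↔ j ∈ V) then s else d := by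
    intro j
    rw [hG, gbmGraph_adj_iff V hx, ne_comm]
    refine and_congr_right fun h => ?_
    rw [relativePosition, if_neg h, norm_sub_rev]
  have hadj2 : ∀ j k, j ≠ i → k ≠ i → (G.Adj j k ↔ j ≠ k ∧
      ‖relativePosition i (fun j => (x j : UnitAddCircle)) j -
        relativePosition i (fun j => (x j : UnitAddCircle)) k‖ ≤
      if (i ∈ V ↔ j ∈ V) ↔ (i ∈ V ↔ k ∈ V) then s else d) := by
    intro j k hj hk
    rw [hG, gbmGraph_adj_iff V hx]
    have e : ((i ∈ V ↔ j ∈ V) ↔ (i ∈ V ↔ k ∈ V)) ↔ (j ∈ V ↔ k ∈ V) := by tauto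
    simp only [relativePosition, if_neg hj, if_neg hk, sub_sub_sub_cancel_right, e]
  have hT : (∑ j, ∑ k, if j ≠ k then G.adjMatrix ℝ i j * G.adjMatrix ℝ j k * G.adjMatrix ℝ k i
      else 0) = rootedCount i (fun j => if (i ∈ V ↔ j ∈ V) then s else d)
          (fun j k => if (i ∈ V ↔ j ∈ V) ↔ (i ∈ V ↔ k ∈ V) then s else d)
          (relativePosition i fun j => x j) := by
    refine Finset.sum_congr rfl fun j _ => Finset.sum_congr rfl fun k _ => ?_
    simp only [SimpleGraph.adjMatrix_apply, G.adj_comm k i, rootedKernel, triangleKernel]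
    by_cases hj : j = i
    · simp [hj]
    by_cases hk : k = i
    · simp [hk]
    rw [hadj j, hadj k, hadj2 j k hj hk]
    by_cases hjk : j = k
    · simp [hjk]
    simp only [hj, hk, hjk, ne_eq, not_false_eq_true, true_and, if_true, ite_and, mul_ite,
      mul_one, mul_zero]
    split_ifs <;> rfl
  have hdeg : (G.degree i : ℝ) = ∑ j, if G.Adj i j then (1 : ℝ) else 0 := by
    rw [← SimpleGraph.card_neighborFinset_eq_degree, SimpleGraph.neighborFinset_eq_filter]
    simp
  have hS : (G.degree i : ℝ) * ((G.degree i : ℝ) - 1) =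
      rootedCount i (fun j => if (i ∈ V ↔ j ∈ V) then s else d) (fun _ _ => 1)
          (relativePosition i fun j => x j) := by
    -- Removing the diagonal `j = k` from the square of the degree turns `d ^ 2` into `d ^ 2 - d`.
    have h1 : ∀ j k, rootedKernel i (fun j => if (i ∈ V ↔ j ∈ V) then s else d) (fun _ _ => 1) j k
        (relativePosition i (fun j => x j) j) (relativePosition i (fun j => x j) k) =
        (if G.Adj i j then (1 : ℝ) else 0) * (if G.Adj i k then 1 else 0) -
          if j = k then (if G.Adj i j then 1 else 0) else 0 := by
      intro j k
      have h2 := norm_unitAddCircle_le_half (relativePosition i (fun j => (x j : UnitAddCircle)) j -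
        relativePosition i (fun j => (x j : UnitAddCircle)) k)
      have h3 := h2.trans (by norm_num : (1 / 2 : ℝ) ≤ 1)
      simp only [rootedKernel, triangleKernel, h3, and_true, hadj]
      by_cases hjk : j = k
      · subst hjk
        simp only [ne_eq, not_true_eq_false, and_false, if_false, if_true]
        split_ifs <;> simp
      · simp only [hjk, ne_eq, not_false_eq_true, and_true, if_false, sub_zero, ite_and]
        split_ifs <;> simp
    simp only [rootedCount, h1, Finset.sum_sub_distrib, ← Finset.mul_sum, ← Finset.sum_mul,
      ← hdeg, Finset.sum_ite_eq, Finset.mem_univ, if_true]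
    ring
  -- For degree 0 or 1 the denominator vanishes, and division by zero already returns the prescribed
  -- value 0.
  have hdiv : ∀ A : ℝ, (if G.degree i ≤ 1 then 0 else
      A / ((G.degree i : ℝ) * ((G.degree i : ℝ) - 1))) =
      A / ((G.degree i : ℝ) * ((G.degree i : ℝ) - 1)) := by
    intro A
    split_ifs with h
    · interval_cases h' : G.degree i <;> simp
    · rfl
  rw [← hT, ← hS]
  refine Eq.trans ?_ (hdiv _)
  congr!

end Graph

/-! ### Averaging over the vertices and convergence in probability -/

theorem clusteringConst_mem_Icc {s d ρ : ℝ} (hd : 0 ≤ d) (hds : d ≤ s) (hρ0 : 0 ≤ ρ)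
    (hρ1 : ρ ≤ 1) : clusteringConst ρ s d ∈ Set.Icc (0 : ℝ) 1 :=
  ⟨div_nonneg (clusteringConst_num_nonneg hd hds hρ0 hρ1) (by positivity),
    div_le_one_of_le₀ (clusteringConst_num_le_den hd hds hρ0 hρ1) (by positivity)⟩

/-- The limit of the average clustering coefficient of the geometric block model. -/
def avgClusteringConst (τ s d : ℝ) : ℝ :=
  τ * clusteringConst τ s d + (1 - τ) * clusteringConst (1 - τ) s d

/-- A bound on the mean deviation of the clustering coefficient of a vertex. -/
def clusteringError (n s d : ℝ) : ℝ :=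
  √(4 * (8 * (n * s) ^ 3 + 4 * (n * s) ^ 2) + (16 * n * s ^ 2) ^ 2) / (n * d) ^ 2

/-- Markov's inequality for the averaged `L¹` errors. The term `1 / (2 * n)` pays for `V.card`
differing from `τ * n` when the limits are averaged. -/
theorem measure_lt_abs_avgClustering_sub_le {Ω : Type*} [MeasurableSpace Ω] {P : Measure Ω}
    [IsProbabilityMeasure P] {n : ℕ} (hn : 0 < n) {τ : ℝ} (hτ : τ ∈ Set.Icc (0 : ℝ) 1)
    (V : Finset (Fin n)) (hV : |(V.card : ℝ) - τ * n| ≤ 1 / 2) {s d : ℝ} (hd : 0 < d) (hds : d ≤ s)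
    (hs : s ≤ 1 / 3) {X : Fin n → Ω → ℝ} (hX : ∀ i, Measurable (X i))
    (hunif : ∀ i, pdf.IsUniform (X i) (Set.Icc (0 : ℝ) 1) P volume) (hindep : iIndepFun X P)
    {ε : ℝ} (hε : 0 < ε) :
    P {ω | ε < |avgClustering (gbmGraph V s d (fun i => X i ω)) - avgClusteringConst τ s d|} ≤
      ENNReal.ofReal ((clusteringError n s d + 1 / (2 * n)) / ε) := by
  classical
  have hn' : (0 : ℝ) < n := by exact_mod_cast hn
  let U : Fin n → Ω → UnitAddCircle := fun j ω => (X j ω : UnitAddCircle)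
  have hcoe : Measurable fun x : ℝ => (x : UnitAddCircle) :=
    (UnitAddCircle.measurePreserving_mk 0).measurable
  have hU : ∀ j, Measurable (U j) := fun j => hcoe.comp (hX j)
  have hUind : iIndepFun U P := hindep.comp (fun _ x => (x : UnitAddCircle)) fun _ => hcoe
  have hUlaw : ∀ j, P.map (U j) = volume := fun j =>
    map_coe_unitAddCircle_of_isUniform (hX j) (hunif j)
  let F : Fin n → Ω → ℝ := fun i ω =>
    rootedCount i (fun j => if (i ∈ V ↔ j ∈ V) then s else d)
        (fun j k => if (i ∈ V ↔ j ∈ V) ↔ (i ∈ V ↔ k ∈ V) then s else d)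
        (fun j => relativePosition i (fun k => U k ω) j) /
      rootedCount i (fun j => if (i ∈ V ↔ j ∈ V) then s else d) (fun _ _ => 1)
        (fun j => relativePosition i (fun k => U k ω) j)
  let ρ : Fin n → ℝ := fun i => if i ∈ V then τ else 1 - τ
  have hρ : ∀ i, 0 ≤ ρ i ∧ ρ i ≤ 1 := fun i => by
    simp only [ρ]; split_ifs <;> constructor <;> linarith [hτ.1, hτ.2]
  have hcard : ∀ i, |((Finset.univ.filter fun j => (i ∈ V ↔ j ∈ V)).card : ℝ) -
      ρ i * Fintype.card (Fin n)| ≤ 1 / 2 := by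
    intro i
    rw [Fintype.card_fin]
    by_cases hi : i ∈ V
    · simpa [hi, ρ] using hV
    -- Outside `V` the community of the root is the complement, with proportion `1 - τ` and the same
    -- rounding error.
    · have h1 : (Finset.univ.filter fun j => (i ∈ V ↔ j ∈ V)) = Vᶜ := by
        ext j; simp [hi]
      have h2 : ((Vᶜ.card : ℕ) : ℝ) = n - V.card := by
        rw [Finset.card_compl, Fintype.card_fin, Nat.cast_sub]
        simpa using Finset.card_le_univ V
      rw [h1, h2, abs_sub_comm]
      simp only [ρ, if_neg hi]
      convert hV using 2
      ring
  have hF : ∀ i, Measurable (F i) := fun i =>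
    have hm := measurable_pi_lambda _ (measurable_relativePosition hU i)
    ((measurable_rootedCount ..).comp hm).div ((measurable_rootedCount ..).comp hm)
  have hF01 : ∀ i ω, F i ω ∈ Set.Icc (0 : ℝ) 1 := fun i ω =>
    ⟨div_nonneg (rootedCount_nonneg ..) (rootedCount_nonneg ..),
      div_le_one_of_le₀ (rootedCount_le_of_one_half_le _ _ _ (fun _ _ => by norm_num) _)
        (rootedCount_nonneg ..)⟩
  have hE : ∀ i, ∫ ω, |F i ω - clusteringConst (ρ i) s d| ∂P ≤ clusteringError n s d := by
    intro i
    have := integral_abs_rootedCount_div_sub_le (σ := fun j => (i ∈ V ↔ j ∈ V)) i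
      (measurable_relativePosition hU i) (iIndepFun_relativePosition hU hUind hUlaw i)
      (map_relativePosition_apply hU hUind hUlaw i) hd hds hs (hρ i).1 (hρ i).2 (hcard i)
    rw [Fintype.card_fin] at this
    exact this
  have hFi : ∀ i, Integrable (fun ω => |F i ω - clusteringConst (ρ i) s d|) P := fun i => by
    refine ((Integrable.of_bound (hF i).aestronglyMeasurable 1 (ae_of_all _ fun ω => ?_)).sub
      (integrable_const _)).abs
    rw [Real.norm_of_nonneg (hF01 i ω).1]
    exact (hF01 i ω).2
  let G : Ω → ℝ := fun ω =>
    1 / n * ∑ i, |F i ω - clusteringConst (ρ i) s d| + 1 / (2 * n)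
  have hGint : Integrable G P :=
    ((integrable_finsetSum _ fun i _ => hFi i).const_mul _).add (integrable_const _)
  have hGle : ∫ ω, G ω ∂P ≤ clusteringError n s d + 1 / (2 * n) := by
    simp only [G]
    rw [integral_add ((integrable_finsetSum _ fun i _ => hFi i).const_mul _) (integrable_const _),
      integral_const_mul, integral_finsetSum _ fun i _ => hFi i, integral_const, probReal_univ,
      one_smul]
    refine add_le_add_left ?_ _
    calc 1 / (n : ℝ) * ∑ i, ∫ ω, |F i ω - clusteringConst (ρ i) s d| ∂P
        ≤ 1 / (n : ℝ) * ∑ _i : Fin n, clusteringError n s d := by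
          gcongr with i
          exact hE i
      _ = clusteringError n s d := by
          simp only [Finset.sum_const, Finset.card_univ, Fintype.card_fin, nsmul_eq_mul]
          field_simp
  have hmean : |1 / n * ∑ i, clusteringConst (ρ i) s d - avgClusteringConst τ s d| ≤
      1 / (2 * n) := by
    have h1 : ∑ i, clusteringConst (ρ i) s d =
        V.card * clusteringConst τ s d + (n - V.card) * clusteringConst (1 - τ) s d := by
      have := sum_ite_community (fun i => i ∈ V) (clusteringConst τ s d)
        (clusteringConst (1 - τ) s d)
      simp only [Finset.filter_univ_mem, Fintype.card_fin] at this
      rw [← this]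
      refine Finset.sum_congr rfl fun i _ => ?_
      simp only [ρ]
      split_ifs <;> rfl
    have h2 := clusteringConst_mem_Icc hd.le hds hτ.1 hτ.2
    have h3 := clusteringConst_mem_Icc (ρ := 1 - τ) hd.le hds (by linarith [hτ.2])
      (by linarith [hτ.1])
    have h4 : |clusteringConst τ s d - clusteringConst (1 - τ) s d| ≤ 1 :=
      abs_le.2 ⟨by linarith [h2.1, h3.2], by linarith [h2.2, h3.1]⟩
    have e : 1 / n * ∑ i, clusteringConst (ρ i) s d - avgClusteringConst τ s d =
        (V.card - τ * n) * (clusteringConst τ s d - clusteringConst (1 - τ) s d) / n := by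
      rw [h1, avgClusteringConst]
      field_simp
      ring
    rw [e, abs_div, abs_mul, abs_of_pos hn', div_le_iff₀ hn']
    calc _ ≤ 1 / 2 * (1 : ℝ) := by gcongr
      _ = 1 / (2 * (n : ℝ)) * n := by field_simp
  have hsub : ∀ᵐ ω ∂P, ε < |avgClustering (gbmGraph V s d (fun i => X i ω)) -
      avgClusteringConst τ s d| → ε ≤ G ω := by
    filter_upwards [ae_all_iff.2 fun i => ae_mem_Icc_of_isUniform (hX i) (hunif i)] with ω hω h
    refine h.le.trans ?_
    rw [avgClustering_gbmGraph V hω]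
    have e : 1 / (n : ℝ) * ∑ i, F i ω - avgClusteringConst τ s d =
        1 / (n : ℝ) * ∑ i, (F i ω - clusteringConst (ρ i) s d) +
          (1 / n * ∑ i, clusteringConst (ρ i) s d - avgClusteringConst τ s d) := by
      rw [Finset.sum_sub_distrib]
      ring
    calc |1 / (n : ℝ) * ∑ i, F i ω - avgClusteringConst τ s d|
        ≤ |1 / (n : ℝ) * ∑ i, (F i ω - clusteringConst (ρ i) s d)| +
          |1 / n * ∑ i, clusteringConst (ρ i) s d - avgClusteringConst τ s d| := by
          rw [e]; exact abs_add_le _ _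
      _ ≤ G ω := by
          refine add_le_add ?_ hmean
          rw [abs_mul, abs_of_pos (by positivity)]
          gcongr
          exact Finset.abs_sum_le_sum_abs _ _
  have hmarkov := mul_meas_ge_le_integral_of_nonneg (μ := P) (f := G)
    (ae_of_all _ fun ω => by simp only [G, Pi.zero_apply]; positivity) hGint ε
  refine (measure_mono_ae (t := {ω | ε ≤ G ω}) hsub).trans ?_
  rw [← ofReal_measureReal (measure_ne_top _ _)]
  refine ENNReal.ofReal_le_ofReal ?_
  rw [le_div_iff₀ hε, mul_comm]
  exact hmarkov.trans hGle

/-- Taking `(n * s) ^ 4` out of the root and using `s ≤ C * d` cancels the denominator, leaving only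
powers of `(n * s)⁻¹` and `n⁻¹`. -/
theorem clusteringError_le {n s d C : ℝ} (hn : 0 < n) (hs : 0 < s) (hd : 0 < d)
    (hsd : s ≤ C * d) :
    clusteringError n s d ≤
      C ^ 2 * √(32 * (n * s)⁻¹ + 16 * (n * s)⁻¹ ^ 2 + 256 * n⁻¹ ^ 2) := by
  have hu : 0 < n * s := mul_pos hn hs
  have e : 4 * (8 * (n * s) ^ 3 + 4 * (n * s) ^ 2) + (16 * n * s ^ 2) ^ 2 =
      (32 * (n * s)⁻¹ + 16 * (n * s)⁻¹ ^ 2 + 256 * n⁻¹ ^ 2) * ((n * s) ^ 2) ^ 2 := by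
    field_simp
    ring
  rw [clusteringError, e, Real.sqrt_mul (by positivity), Real.sqrt_sq (by positivity),
    div_le_iff₀ (by positivity)]
  have h : (n * s) ^ 2 ≤ C ^ 2 * (n * d) ^ 2 := by
    rw [← mul_pow]
    refine pow_le_pow_left₀ hu.le ?_ 2
    nlinarith
  calc _ ≤ √(32 * (n * s)⁻¹ + 16 * (n * s)⁻¹ ^ 2 + 256 * n⁻¹ ^ 2) * (C ^ 2 * (n * d) ^ 2) := by
        gcongr
    _ = _ := by ring

theorem isLittleOPOne_avgClustering_sub
    {Ω : ℕ → Type*} [∀ n, MeasurableSpace (Ω n)] (μ : ∀ n, Measure (Ω n))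
    [∀ n, IsProbabilityMeasure (μ n)] (τ : ℝ) (hτ : τ ∈ Set.Icc (0 : ℝ) 1)
    (V₁ : ∀ n, Finset (Fin n)) (hV₁ : ∀ n, |((V₁ n).card : ℝ) - τ * n| ≤ 1 / 2)
    (rs rd : ℕ → ℝ) (hle : ∀ n, rd n ≤ rs n) (hrd : ∀ n, 0 ≤ rd n)
    (hthird : ∀ᶠ n in atTop, rs n ≤ 1 / 3)
    (X : ∀ n, Fin n → Ω n → ℝ) (hX : ∀ n i, Measurable (X n i))
    (hunif : ∀ n i, pdf.IsUniform (X n i) (Set.Icc (0 : ℝ) 1) (μ n) volume)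
    (hindep : ∀ n, iIndepFun (X n) (μ n)) (hO : rs =O[atTop] rd)
    (hdeg : Tendsto (fun n : ℕ => (n : ℝ) * rs n) atTop atTop) {c : ℕ → ℝ}
    (hc : ∀ᶠ n in atTop, c n = avgClusteringConst τ (rs n) (rd n)) :
    IsLittleOPOne μ fun n ω =>
      avgClustering (gbmGraph (V₁ n) (rs n) (rd n) (fun i => X n i ω)) - c n := by
  intro ε hε
  obtain ⟨C, hC, hCO⟩ := hO.exists_pos
  let e : ℕ → ℝ := fun n => (C ^ 2 * √(32 * ((n : ℝ) * rs n)⁻¹ + 16 * ((n : ℝ) * rs n)⁻¹ ^ 2 +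
    256 * (n : ℝ)⁻¹ ^ 2) + 2⁻¹ * (n : ℝ)⁻¹) / ε
  have he : Tendsto e atTop (𝓝 0) := by
    have h1 := hdeg.inv_tendsto_atTop
    have h2 : Tendsto (fun n : ℕ => (n : ℝ)⁻¹) atTop (𝓝 0) := tendsto_inv_atTop_nhds_zero_nat
    have h3 := ((((((h1.const_mul 32).add ((h1.pow 2).const_mul 16)).add
      ((h2.pow 2).const_mul 256)).sqrt).const_mul (C ^ 2)).add (h2.const_mul 2⁻¹)).div_const ε
    refine (h3.congr fun n => rfl).trans ?_
    simp
  have he' : Tendsto (fun n => ENNReal.ofReal (e n)) atTop (𝓝 0) := by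
    simpa using ENNReal.tendsto_ofReal he
  refine tendsto_of_tendsto_of_tendsto_of_le_of_le' tendsto_const_nhds he'
    (Eventually.of_forall fun _ => zero_le) ?_
  filter_upwards [hc, hthird, hCO.bound, hdeg.eventually_gt_atTop 0, eventually_gt_atTop 0]
    with n hcn hs hsC hns hn
  have hn' : (0 : ℝ) < n := by exact_mod_cast hn
  have hs0 : 0 < rs n := pos_of_mul_pos_right hns hn'.le
  rw [Real.norm_of_nonneg hs0.le, Real.norm_of_nonneg (hrd n)] at hsC
  -- Positivity of `rd n` is forced by `0 < rs n ≤ C * rd n`.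
  have hd0 : 0 < rd n := pos_of_mul_pos_right (hs0.trans_le hsC) hC.le
  rw [hcn]
  refine (measure_lt_abs_avgClustering_sub_le hn hτ (V₁ n) (hV₁ n) hd0 (hle n) hs (hX n)
    (hunif n) (hindep n) hε).trans (ENNReal.ofReal_le_ofReal ?_)
  have := clusteringError_le hn' hs0 hd0 hsC
  simp only [e]
  rw [one_div, mul_inv]
  gcongr

end

theorem theorem2
    {Ω : ℕ → Type*} [∀ n, MeasurableSpace (Ω n)] (μ : ∀ n, Measure (Ω n))
    [∀ n, IsProbabilityMeasure (μ n)]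
    -- the community proportion and the communities: `|V₁|` is `τ n` or, if that is not an integer,
    -- an integer nearest to it; `V₂` is the complement of `V₁`
    (τ : ℝ) (hτ : τ ∈ Set.Icc (0 : ℝ) 1)
    (V₁ : ∀ n, Finset (Fin n)) (hV₁ : ∀ n, |((V₁ n).card : ℝ) - τ * n| ≤ 1 / 2)
    -- the radii
    (rs rd : ℕ → ℝ)
    (hrs : ∀ n, rs n ∈ Set.Icc (0 : ℝ) (1 / 2)) (hrd : ∀ n, rd n ∈ Set.Icc (0 : ℝ) (1 / 2))
    (hle : ∀ n, rd n ≤ rs n)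
    (hthird : ∀ᶠ n in atTop, rs n ≤ 1 / 3)
    -- independent uniform positions on the unit interval
    (X : ∀ n, Fin n → Ω n → ℝ) (hX : ∀ n i, Measurable (X n i))
    (hunif : ∀ n i, pdf.IsUniform (X n i) (Set.Icc (0 : ℝ) 1) (μ n) volume)
    (hindep : ∀ n, iIndepFun (X n) (μ n))
    -- `rs = Θ(rd)` and `n rs → ∞`
    (htheta : rs =Θ[atTop] rd)
    (hdeg : Tendsto (fun n : ℕ => (n : ℝ) * rs n) atTop atTop) :
    ((∀ᶠ n in atTop, rs n < 2 * rd n) →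
      IsLittleOPOne μ fun n ω =>
        avgClustering (gbmGraph (V₁ n) (rs n) (rd n) (fun i => X n i ω)) -
          (τ * (3 * τ ^ 2 * rs n ^ 2 + (1 - τ ^ 2) * (4 * rs n * rd n - rs n ^ 2)) /
              (4 * (τ * rs n + (1 - τ) * rd n) ^ 2) +
            (1 - τ) * (3 * (1 - τ) ^ 2 * rs n ^ 2
                + τ * (2 - τ) * (4 * rs n * rd n - rs n ^ 2)) /
              (4 * (τ * rd n + (1 - τ) * rs n) ^ 2))) ∧
    ((∀ᶠ n in atTop, 2 * rd n ≤ rs n) →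
      IsLittleOPOne μ fun n ω =>
        avgClustering (gbmGraph (V₁ n) (rs n) (rd n) (fun i => X n i ω)) -
          (τ * (3 * τ ^ 2 * rs n ^ 2 + 4 * rd n ^ 2 * (1 - τ ^ 2)) /
              (4 * (τ * rs n + (1 - τ) * rd n) ^ 2) +
            (1 - τ) * (3 * (1 - τ) ^ 2 * rs n ^ 2 + 4 * rd n ^ 2 * τ * (2 - τ)) /
              (4 * (τ * rd n + (1 - τ) * rs n) ^ 2)))
  := by
  have hmain := fun c hc => isLittleOPOne_avgClustering_sub μ τ hτ V₁ hV₁ rs rd hle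
    (fun n => (hrd n).1) hthird X hX hunif hindep htheta.1 hdeg (c := c) hc
  constructor
  · intro h
    refine hmain _ ?_
    filter_upwards [h] with n hn
    -- Here `4 d ^ 2 - (2 d - s) ^ 2 = 4 s d - s ^ 2`, and `1 - (1 - τ) ^ 2 = τ (2 - τ)`.
    rw [avgClusteringConst, clusteringConst, clusteringConst, mixedTriangleProb,
      max_eq_right (by linarith)]
    ring_nf
  · intro h
    refine hmain _ ?_
    filter_upwards [h] with n hn
    rw [avgClusteringConst, clusteringConst, clusteringConst, mixedTriangleProb,
      max_eq_left (by linarith)]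
    ring_nf
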